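/- Let $\mathbb F$ be $\mathbb R$ or $\mathbb C$. A minimal system in a quasi-Banach space $(\mathbb Y,\|\cdot\|)$ over $\mathbb F$ is a sequence $\mathcal Y=(y_n)_{n=1}^\infty$ in $\mathbb Y$ for which there are continuous linear functionals $y_n^*$ with $y_n^*(y_k)=\delta_{n,k}$. It is complete if its closed linear span is $\mathbb Y$, and it is a Markushevich basis if, moreover, $f\mapsto (y_n^*(f))_{n}$ is one-to-one on $\mathbb Y$. For finite $A\subset\mathbb N$ put $S_A(f)=\sum_{n\in A}y_n^*(f)\,y_n$; a finite set $A\subset\mathbb N$ is a greedy set of $f\in\mathbb Y$ if $|y_n^*(f)|\ge |y_k^*(f)|$ for all $n\in A$, $k\notin A$. A complete minimal system with $0<\inf_n\|y_n\|\le\sup_n\|y_n\|<\infty$ and $\sup_n\|S_{\{n\}}\|<\infty$ is called quasi-greedy if $\sup\{\|f-S_A(f)\| : \|f\|\le 1,\ A \text{ a greedy set of } f\}<\infty$, and almost greedy if there is a constant $C\ge 1$ such that $\|f-S_A(f)\|\le C\|f-S_B(f)\|$ for all $f\in\mathbb Y$, all greedy sets $A$ of $f$ and all $B\subset\mathbb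 N$ with $|B|\le|A|$. A minimal system is symmetric if there is a constant $C\ge 1$ such that $\|\sum_n a_n y_n\|\le C\|\sum_n a_n y_{\pi(n)}\|$ for all finitely supported scalar sequences $(a_n)$ and all permutations $\pi$ of $\mathbb N$. A sequence $(x_n)_{n=1}^\infty$ in $\mathbb Y$ is a Schauder basis if for every $f\in\mathbb Y$ there is a unique scalar sequence $(a_n)$ such that $\sum_{n=1}^\infty a_n x_n$ converges to $f$. **Theorem.** There is a quasi-Banach space $\mathbb Y$ over $\mathbb F$ with an almost greedy Markushevich basis $\mathcal Y=(y_n)_{n=1}^\infty$ such that for no permutation $\pi$ of $\mathbb N$ is $(y_{\pi(n)})_{n=1}^\infty$ a Schauder basis of $\mathbb Y$. Furthermore, $\mathcal Y$ can be chosen to be symmetric. In particular, there is a quasi-greedy basis that fails to be a Schauder basis under every reordering. -/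

import Mathlib

universe u

open Filter Topology

/-- `X`, with its given uniform (in particular, topological) group structure and the gauge `q`, is
a quasi-Banach space over `𝕜`: `q` is a quasi-norm, the balls of `q` form a basis of
neighbourhoods of the origin, and `X` is complete. -/
structure IsQuasiBanachSpace (𝕜 : Type u) {X : Type u} [RCLike 𝕜] [AddCommGroup X] [Module 𝕜 X]
    [UniformSpace X] [IsUniformAddGroup X] (q : X → ℝ) : Prop where
  nonneg : ∀ f : X, 0 ≤ q f
  pos : ∀ f : X, f ≠ 0 → 0 < q f
  smul : ∀ (t : 𝕜) (f : X), q (t • f) = ‖t‖ * q f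
  add_le : ∃ κ : ℝ, ∀ f g : X, q (f + g) ≤ κ * (q f + q g)
  nhds_zero : (𝓝 (0 : X)).HasBasis (fun r : ℝ => 0 < r) (fun r => {f : X | q f ≤ r})
  complete : CompleteSpace X

/-- A minimal system: a sequence of vectors together with biorthogonal continuous linear
functionals (its coordinate functionals). -/
structure MinimalSystem (𝕜 : Type u) (X : Type u) [RCLike 𝕜] [AddCommGroup X] [Module 𝕜 X]
    [TopologicalSpace X] where
  vec : ℕ → X
  coord : ℕ → X →L[𝕜] 𝕜
  biorthogonal : ∀ n k : ℕ, coord n (vec k) = if n = k then 1 else 0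

namespace MinimalSystem

variable {𝕜 X : Type u} [RCLike 𝕜] [AddCommGroup X] [Module 𝕜 X] [TopologicalSpace X]

/-- The closed linear span of the system is the whole space. -/
def IsComplete (𝓧 : MinimalSystem 𝕜 X) : Prop :=
  Dense (Submodule.span 𝕜 (Set.range 𝓧.vec) : Set X)

/-- The coefficient transform `f ↦ (xₙ*(f))ₙ` is one-to-one. -/
def IsTotal (𝓧 : MinimalSystem 𝕜 X) : Prop :=
  Function.Injective fun (f : X) (n : ℕ) => 𝓧.coord n f

/-- A Markushevich basis is a complete and total minimal system. -/
def IsMarkushevichBasis (𝓧 : MinimalSystem 𝕜 X) : Prop :=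
  𝓧.IsComplete ∧ 𝓧.IsTotal

/-- The coordinate projection `S_A(f) = ∑_{n ∈ A} xₙ*(f) xₙ`. -/
noncomputable def proj (𝓧 : MinimalSystem 𝕜 X) (A : Finset ℕ) (f : X) : X :=
  ∑ n ∈ A, 𝓧.coord n f • 𝓧.vec n

/-- `inf ‖xₙ‖ > 0` and `sup ‖xₙ‖ < ∞`. -/
def IsSemiNormalized (q : X → ℝ) (𝓧 : MinimalSystem 𝕜 X) : Prop :=
  ∃ c C : ℝ, 0 < c ∧ ∀ n, c ≤ q (𝓧.vec n) ∧ q (𝓧.vec n) ≤ C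

/-- The projections onto single coordinates are uniformly bounded. -/
def IsMBounded (q : X → ℝ) (𝓧 : MinimalSystem 𝕜 X) : Prop :=
  ∃ C : ℝ, ∀ (n : ℕ) (f : X), q (𝓧.proj {n} f) ≤ C * q f

/-- A complete, semi-normalized, `M`-bounded minimal system. -/
def IsWBasis (q : X → ℝ) (𝓧 : MinimalSystem 𝕜 X) : Prop :=
  𝓧.IsComplete ∧ 𝓧.IsSemiNormalized q ∧ 𝓧.IsMBounded q

/-- `A` is a greedy set of `f`. -/
def IsGreedySet (𝓧 : MinimalSystem 𝕜 X) (f : X) (A : Finset ℕ) : Prop :=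
  ∀ n ∈ A, ∀ k ∉ A, ‖𝓧.coord k f‖ ≤ ‖𝓧.coord n f‖

/-- A quasi-greedy basis. -/
def IsQuasiGreedyBasis (q : X → ℝ) (𝓧 : MinimalSystem 𝕜 X) : Prop :=
  𝓧.IsWBasis q ∧ ∃ C : ℝ, ∀ (f : X) (A : Finset ℕ), q f ≤ 1 → 𝓧.IsGreedySet f A →
    q (f - 𝓧.proj A f) ≤ C

/-- An almost greedy basis. -/
def IsAlmostGreedyBasis (q : X → ℝ) (𝓧 : MinimalSystem 𝕜 X) : Prop :=
  𝓧.IsWBasis q ∧ ∃ C : ℝ, 1 ≤ C ∧ ∀ (f : X) (A B : Finset ℕ), 𝓧.IsGreedySet f A →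
    B.card ≤ A.card → q (f - 𝓧.proj A f) ≤ C * q (f - 𝓧.proj B f)

/-- A symmetric system: permuting the vectors changes the gauge of finite linear combinations
by at most a fixed factor. -/
def IsSymmetric (q : X → ℝ) (𝓧 : MinimalSystem 𝕜 X) : Prop :=
  ∃ C : ℝ, 1 ≤ C ∧ ∀ (π : Equiv.Perm ℕ) (a : ℕ →₀ 𝕜),
    q (a.sum fun n t => t • 𝓧.vec n) ≤ C * q (a.sum fun n t => t • 𝓧.vec (π n))

end MinimalSystem

/-- A Schauder basis: every vector has a unique expansion as a convergent series. -/
def IsSchauderBasis (𝕜 : Type u) {X : Type u} [RCLike 𝕜] [AddCommGroup X] [Module 𝕜 X]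
    [TopologicalSpace X] (x : ℕ → X) : Prop :=
  ∀ f : X, ∃! a : ℕ → 𝕜,
    Tendsto (fun m : ℕ => ∑ n ∈ Finset.range m, a n • x n) atTop (𝓝 f)

/-! The quasi-norm of a sequence is the larger of its weak-`ℓ₁` size and the supremum of `‖∑_{n ∈ A}
f n‖` over its greedy sets `A` on which `f` does not vanish. The space is the closure of the
finitely supported sequences, and the basis consists of the unit vectors. Nothing in the quasi-norm
refers to the order of `ℕ`, which gives symmetry.

The triangle inequality is `IsGreedyBound.add`: truncation above a level `t` is additive except on
`O(1/t)` indices, each with error `O(t)`. Removing a greedy set at most doubles the quasi-norm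
(`sub_greedy`). Flat vectors are controlled by weak `ℓ₁` alone (`of_flat`), which upgrades
quasi-greedy to almost greedy.

The set of nonzero entries of a finitely supported vector is greedy, so the quasi-norm dominates its
total sum. A convergent expansion therefore has bounded partial sums of coefficients. Now put `d i =
1 / ((i + 2) log (i + 2))` at odd positions and `-d i` at sparse even ones. Greedy sums take the two
copies together, up to ties, so they cancel; the tails are small because `i * d i → 0`. In the
natural order the negative copies come late, and `∑ d i = ∞` makes the partial sums unbounded. By
symmetry this example can be transported to every ordering. -/

variable {𝕜 : Type u} [RCLike 𝕜]

/-! ### Greedy bounds and their stability -/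

/-- `C` bounds the weak-`ℓ₁` size of `f` as well as all the sums of `f` over its greedy sets. -/
structure IsGreedyBound (f : ℕ → 𝕜) (C : ℝ) : Prop where
  nonneg : 0 ≤ C
  card_mul_le : ∀ t : ℝ, 0 < t → ∀ A : Finset ℕ, (∀ n ∈ A, t ≤ ‖f n‖) → A.card * t ≤ C
  norm_sum_le : ∀ t : ℝ, 0 < t → ∀ A : Finset ℕ, (∀ n ∈ A, t ≤ ‖f n‖) →
    (∀ n ∉ A, ‖f n‖ ≤ t) → ‖∑ n ∈ A, f n‖ ≤ C

namespace IsGreedyBound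

variable {f g : ℕ → 𝕜} {C D : ℝ}

theorem mono (h : IsGreedyBound f C) (hCD : C ≤ D) : IsGreedyBound f D where
  nonneg := h.nonneg.trans hCD
  card_mul_le t ht A hA := (h.card_mul_le t ht A hA).trans hCD
  norm_sum_le t ht A hA hA' := (h.norm_sum_le t ht A hA hA').trans hCD

theorem zero : IsGreedyBound (0 : ℕ → 𝕜) 0 where
  nonneg := le_rfl
  card_mul_le t ht A hA := by
    have : A = ∅ := by
      refine Finset.eq_empty_of_forall_notMem fun n hn => ?_
      have := hA n hn
      simp at this
      linarith
    simp [this]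
  norm_sum_le t ht A hA hA' := by simp

theorem smul (h : IsGreedyBound f C) {c : 𝕜} (hc : c ≠ 0) : IsGreedyBound (c • f) (‖c‖ * C) := by
  have hc' : 0 < ‖c‖ := norm_pos_iff.2 hc
  have key : ∀ t n, t ≤ ‖(c • f) n‖ ↔ t / ‖c‖ ≤ ‖f n‖ := fun t n => by
    rw [div_le_iff₀ hc', Pi.smul_apply, norm_smul, mul_comm]
  have key' : ∀ t n, ‖(c • f) n‖ ≤ t ↔ ‖f n‖ ≤ t / ‖c‖ := fun t n => by
    rw [le_div_iff₀ hc', Pi.smul_apply, norm_smul, mul_comm]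
  refine ⟨by have := h.nonneg; positivity, fun t ht A hA => ?_, fun t ht A hA hA' => ?_⟩
  · have := h.card_mul_le (t / ‖c‖) (by positivity) A fun n hn => (key t n).1 (hA n hn)
    rw [← mul_div_assoc, div_le_iff₀ hc'] at this
    linarith
  · have := h.norm_sum_le (t / ‖c‖) (by positivity) A (fun n hn => (key t n).1 (hA n hn))
      fun n hn => (key' t n).1 (hA' n hn)
    simp only [Pi.smul_apply]
    rw [← Finset.smul_sum, norm_smul]
    gcongr

theorem norm_apply_le (h : IsGreedyBound f C) (n : ℕ) : ‖f n‖ ≤ C := by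
  rcases eq_or_ne (f n) 0 with h0 | h0
  · simpa [h0] using h.nonneg
  · simpa using h.card_mul_le ‖f n‖ (norm_pos_iff.2 h0) {n} (by simp)

theorem exists_superlevel (h : IsGreedyBound f C) {t : ℝ} (ht : 0 < t) :
    ∃ B : Finset ℕ, ∀ n, n ∈ B ↔ t < ‖f n‖ := by
  have hfin : {n | t < ‖f n‖}.Finite := by
    by_contra hinf
    obtain ⟨N, hN⟩ := exists_nat_gt (C / t)
    obtain ⟨B, hB, hcard⟩ := Set.Infinite.exists_subset_card_eq hinf N
    have := h.card_mul_le t ht B fun n hn => le_of_lt (hB hn)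
    rw [div_lt_iff₀ ht] at hN
    rw [hcard] at this
    linarith
  exact ⟨hfin.toFinset, by simp⟩

theorem norm_sum_superlevel_le (h : IsGreedyBound f C) {t : ℝ} (ht : 0 < t) {B : Finset ℕ}
    (hB : ∀ n, n ∈ B ↔ t < ‖f n‖) : ‖∑ n ∈ B, f n‖ ≤ C :=
  h.norm_sum_le t ht B (fun n hn => ((hB n).1 hn).le)
    fun n hn => not_lt.1 fun h' => hn ((hB n).2 h')

theorem card_superlevel_mul_le (h : IsGreedyBound f C) {t : ℝ} (ht : 0 < t) {B : Finset ℕ}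
    (hB : ∀ n, n ∈ B ↔ t < ‖f n‖) : B.card * t ≤ C :=
  h.card_mul_le t ht B fun n hn => ((hB n).1 hn).le

theorem card_mul_le_add (hf : IsGreedyBound f C) (hg : IsGreedyBound g D) {t : ℝ} (ht : 0 < t)
    {A : Finset ℕ} (hA : ∀ n ∈ A, t ≤ ‖(f + g) n‖) : A.card * t ≤ 2 * (C + D) := by
  classical
  have h1 := hf.card_mul_le (t / 2) (by positivity) (A.filter fun n => t / 2 ≤ ‖f n‖) (by simp)
  have h2 := hg.card_mul_le (t / 2) (by positivity) (A.filter fun n => t / 2 ≤ ‖g n‖) (by simp)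
  have h3 : A ⊆ (A.filter fun n => t / 2 ≤ ‖f n‖) ∪ (A.filter fun n => t / 2 ≤ ‖g n‖) := by
    intro n hn
    have h4 := hA n hn
    have h5 := norm_add_le (f n) (g n)
    rw [Pi.add_apply] at h4
    simp only [Finset.mem_union, Finset.mem_filter, hn, true_and]
    by_contra! hcon
    linarith
  have h4 : (A.card : ℝ) ≤ (A.filter fun n => t / 2 ≤ ‖f n‖).card +
      (A.filter fun n => t / 2 ≤ ‖g n‖).card := by
    exact_mod_cast (Finset.card_le_card h3).trans (Finset.card_union_le _ _)
  nlinarith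

/-- The sum of the parts above a level `t` is additive up to an error controlled by the
weak-`ℓ₁` sizes. -/
theorem add (hf : IsGreedyBound f C) (hg : IsGreedyBound g D) :
    IsGreedyBound (f + g) (7 * (C + D)) := by
  classical
  have hC := hf.nonneg
  have hD := hg.nonneg
  refine ⟨by positivity, fun t ht A hA => ?_, fun t ht A hA hA' => ?_⟩
  · linarith [card_mul_le_add hf hg ht hA]
  obtain ⟨B, hB⟩ := hf.exists_superlevel ht
  obtain ⟨E, hE⟩ := hg.exists_superlevel ht
  have hA1 := card_mul_le_add hf hg ht hA
  have hB1 := hf.card_superlevel_mul_le ht hB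
  have hE1 := hg.card_superlevel_mul_le ht hE
  have hB2 := hf.norm_sum_superlevel_le ht hB
  have hE2 := hg.norm_sum_superlevel_le ht hE
  -- The constant 7: on `U` the truncation of `f + g` differs from those of `f` and `g` by at most
  -- `2 * t` per index, and `U.card * t ≤ 3 * (C + D)`. This costs `6 * (C + D)`, and the sums over
  -- `B` and `E` add `C + D`.
  set U := A ∪ (B ∪ E) with hU
  have hUcard : (U.card : ℝ) ≤ A.card + (B.card + E.card) := by
    exact_mod_cast (Finset.card_union_le _ _).trans
      (Nat.add_le_add_left (Finset.card_union_le _ _) _)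
  have hsum : ∑ n ∈ A, (f + g) n = ∑ n ∈ B, f n + ∑ n ∈ E, g n +
      ∑ n ∈ U, ((if n ∈ A then (f + g) n else 0) - (if n ∈ B then f n else 0) -
        (if n ∈ E then g n else 0)) := by
    rw [Finset.sum_sub_distrib, Finset.sum_sub_distrib, Finset.sum_ite_mem, Finset.sum_ite_mem,
      Finset.sum_ite_mem, Finset.inter_eq_right.2 (by rw [hU]; exact Finset.subset_union_left),
      Finset.inter_eq_right.2 (by rw [hU]; intro n hn; simp [hn]),
      Finset.inter_eq_right.2 (by rw [hU]; intro n hn; simp [hn])]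
    ring
  have hterm : ∀ n ∈ U, ‖(if n ∈ A then (f + g) n else 0) - (if n ∈ B then f n else 0) -
        (if n ∈ E then g n else 0)‖ ≤ 2 * t := by
    intro n _
    by_cases h2 : n ∈ B
    · by_cases h3 : n ∈ E
      · by_cases h1 : n ∈ A
        · simp [h1, h2, h3, ht.le]
        · have h4 := hA' n h1
          have : (0 : 𝕜) - f n - g n = -((f + g) n) := by simp; ring
          rw [if_neg h1, if_pos h2, if_pos h3, this, norm_neg]
          linarith
      · have h5 : ‖g n‖ ≤ t := not_lt.1 fun h => h3 ((hE n).2 h)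
        by_cases h1 : n ∈ A
        · simp [h1, h2, h3]
          linarith
        · have h4 := hA' n h1
          have h6 := norm_sub_le (g n) ((f + g) n)
          have : (0 : 𝕜) - f n - 0 = g n - (f + g) n := by simp
          rw [if_neg h1, if_pos h2, if_neg h3, this]
          linarith
    · have h5 : ‖f n‖ ≤ t := not_lt.1 fun h => h2 ((hB n).2 h)
      by_cases h3 : n ∈ E
      · by_cases h1 : n ∈ A
        · simp [h1, h2, h3]
          linarith
        · have h4 := hA' n h1
          have h6 := norm_sub_le (f n) ((f + g) n)
          have : (0 : 𝕜) - 0 - g n = f n - (f + g) n := by simp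
          rw [if_neg h1, if_neg h2, if_pos h3, this]
          linarith
      · have h7 : ‖g n‖ ≤ t := not_lt.1 fun h => h3 ((hE n).2 h)
        by_cases h1 : n ∈ A
        · have h6 := norm_add_le (f n) (g n)
          simp only [h1, h2, h3, if_true, if_false, sub_zero, Pi.add_apply]
          linarith
        · simp [h1, h2, h3, ht.le]
  have h8 := norm_sum_le_of_le U hterm
  rw [Finset.sum_const, nsmul_eq_mul] at h8
  rw [hsum]
  refine (norm_add₃_le).trans ?_
  nlinarith

theorem comp_perm (h : IsGreedyBound f C) (σ : Equiv.Perm ℕ) : IsGreedyBound (f ∘ σ) C where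
  nonneg := h.nonneg
  card_mul_le t ht A hA := by
    simpa using h.card_mul_le t ht (A.map σ.toEmbedding) (Finset.forall_mem_map.2 fun n hn => hA n hn)
  norm_sum_le t ht A hA hA' := by
    have := h.norm_sum_le t ht (A.map σ.toEmbedding) (Finset.forall_mem_map.2 fun n hn => hA n hn)
      fun n hn => by
        have := hA' (σ.symm n) fun h' => hn (Finset.mem_map.2 ⟨_, h', σ.apply_symm_apply n⟩)
        simpa using this
    simpa using this

/-- Greedy bounds pass to uniform limits, up to a constant. -/
theorem of_uniform_approx
    (hC : 0 ≤ C) (h : ∀ ε : ℝ, 0 < ε → ∃ g, IsGreedyBound g C ∧ ∀ n, ‖f n - g n‖ ≤ ε) :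
    IsGreedyBound f (5 * C) := by
  classical
  have hcard : ∀ t : ℝ, 0 < t → ∀ A : Finset ℕ, (∀ n ∈ A, t ≤ ‖f n‖) → A.card * t ≤ 2 * C := by
    intro t ht A hA
    obtain ⟨g, hg, hfg⟩ := h (t / 2) (by positivity)
    have := hg.card_mul_le (t / 2) (by positivity) A fun n hn => by
      have h1 := hA n hn
      have h2 := hfg n
      have h3 := norm_le_norm_add_norm_sub' (f n) (g n)
      linarith
    linarith
  refine ⟨by positivity, fun t ht A hA => by linarith [hcard t ht A hA], fun t ht A hA hA' => ?_⟩
  refine le_of_forall_pos_le_add fun δ hδ => ?_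
  have hcA := hcard t ht A hA
  have hpos : 0 < δ / (A.card + 1) := by positivity
  -- Closeness `δ / (A.card + 1)` keeps the sums of `f` and `g` over `A` within `δ`; closeness `t`
  -- gives `‖g n‖ ≤ 2 * t` off `A`. Replacing `A` by the greedy set `B` of `g` then costs `2 * C + 2
  -- * C`, and the sum over `B` costs `C`.
  obtain ⟨g, hg, hfg⟩ := h (min t (δ / (A.card + 1))) (lt_min ht hpos)
  obtain ⟨B, hB⟩ := hg.exists_superlevel ht
  have hB1 := hg.card_superlevel_mul_le ht hB
  have hB2 := hg.norm_sum_superlevel_le ht hB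
  have h1 : ‖∑ n ∈ A, (f n - g n)‖ ≤ δ := by
    refine (norm_sum_le_of_le A fun n _ => (hfg n).trans (min_le_right _ _)).trans ?_
    rw [Finset.sum_const, nsmul_eq_mul, ← mul_div_assoc, div_le_iff₀ (by positivity)]
    nlinarith
  have h2 : ‖∑ n ∈ A \ B, g n‖ ≤ A.card * t := by
    refine (norm_sum_le_of_le (A \ B) (f := fun n => g n) fun n hn =>
      (not_lt.1 fun h => (Finset.mem_sdiff.1 hn).2 ((hB n).2 h) : ‖g n‖ ≤ t)).trans ?_
    rw [Finset.sum_const, nsmul_eq_mul]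
    gcongr
    exact Finset.sdiff_subset
  have h3 : ‖∑ n ∈ B \ A, g n‖ ≤ B.card * (2 * t) := by
    refine (norm_sum_le_of_le (B \ A) (f := fun n => g n) fun n hn =>
      (?_ : ‖g n‖ ≤ 2 * t)).trans ?_
    · have h4 := hA' n (Finset.mem_sdiff.1 hn).2
      have h5 := (hfg n).trans (min_le_left _ _)
      have h6 := norm_le_norm_add_norm_sub (f n) (g n)
      linarith
    · rw [Finset.sum_const, nsmul_eq_mul]
      gcongr
      exact Finset.sdiff_subset
  have hsum : ∑ n ∈ A, f n = ∑ n ∈ A, (f n - g n) + (∑ n ∈ A \ B, g n - ∑ n ∈ B \ A, g n) +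
      ∑ n ∈ B, g n := by
    rw [Finset.sum_sub_distrib, Finset.sum_sdiff_sub_sum_sdiff]
    ring
  rw [hsum]
  refine (norm_add₃_le).trans ?_
  have := norm_sub_le (∑ n ∈ A \ B, g n) (∑ n ∈ B \ A, g n)
  nlinarith

/-- The level is the least modulus on `A`; it must be positive, so zero entries are excluded. -/
theorem norm_sum_le_of_greedy (h : IsGreedyBound f C) {A : Finset ℕ}
    (hA : ∀ n ∈ A, ∀ k ∉ A, ‖f k‖ ≤ ‖f n‖) (h0 : ∀ n ∈ A, f n ≠ 0) : ‖∑ n ∈ A, f n‖ ≤ C := by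
  rcases A.eq_empty_or_nonempty with rfl | hne
  · simpa using h.nonneg
  obtain ⟨m, hm, hmin⟩ := A.exists_min_image (fun n => ‖f n‖) hne
  exact h.norm_sum_le ‖f m‖ (norm_pos_iff.2 (h0 m hm)) A hmin (hA m hm)

/-- The set of nonzero entries is itself greedy. This makes summation of all coefficients a bounded
functional on finitely supported vectors, the obstruction to Schauder bases. -/
theorem norm_sum_le_of_support (h : IsGreedyBound f C) {A : Finset ℕ}
    (hA : ∀ n ∉ A, f n = 0) : ‖∑ n ∈ A, f n‖ ≤ C := by
  classical
  rw [← Finset.sum_filter_ne_zero]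
  refine h.norm_sum_le_of_greedy (fun n _ k hk => ?_) (by simp)
  have : f k = 0 := by
    by_contra hk0
    exact hk (Finset.mem_filter.2 ⟨by_contra fun hkA => hk0 (hA k hkA), hk0⟩)
  simp [this]

/-- Removing a greedy set at most doubles a greedy bound. -/
theorem sub_greedy (h : IsGreedyBound f C) {A : Finset ℕ}
    (hA : ∀ n ∈ A, ∀ k ∉ A, ‖f k‖ ≤ ‖f n‖) :
    IsGreedyBound (fun n => if n ∈ A then 0 else f n) (2 * C) := by
  have hC := h.nonneg
  have hdisj : ∀ t : ℝ, 0 < t → ∀ B : Finset ℕ,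
      (∀ n ∈ B, t ≤ ‖(if n ∈ A then 0 else f n)‖) → ∀ n ∈ B, n ∉ A ∧ t ≤ ‖f n‖ := by
    intro t ht B hB n hn
    have := hB n hn
    by_cases hnA : n ∈ A
    · simp [hnA] at this
      linarith
    · exact ⟨hnA, by simpa [hnA] using this⟩
  refine ⟨by positivity, fun t ht B hB => ?_, fun t ht B hB hB' => ?_⟩
  · have := h.card_mul_le t ht B fun n hn => (hdisj t ht B hB n hn).2
    linarith
  rcases B.eq_empty_or_nonempty with rfl | ⟨b, hb⟩
  · simpa using hC
  have hB1 := hdisj t ht B hB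
  -- A nonempty `B` forces `A` above level `t`, so `A` and `A ∪ B` are both greedy for `f`, and the
  -- sum over `B` is a difference of two greedy sums.
  have hAt : ∀ n ∈ A, t ≤ ‖f n‖ := fun n hn => (hB1 b hb).2.trans (hA n hn b (hB1 b hb).1)
  have hAB : Disjoint A B := Finset.disjoint_left.2 fun n hn hn' => (hB1 n hn').1 hn
  have h1 := h.norm_sum_le t ht (A ∪ B) (fun n hn => by
    rcases Finset.mem_union.1 hn with hn | hn
    exacts [hAt n hn, (hB1 n hn).2]) fun n hn => by
      rw [Finset.mem_union, not_or] at hn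
      simpa [hn.1] using hB' n hn.2
  have h2 := h.norm_sum_le_of_greedy hA fun n hn => norm_pos_iff.1 (ht.trans_le (hAt n hn))
  rw [Finset.sum_union hAB] at h1
  have h3 : ∑ n ∈ B, (if n ∈ A then 0 else f n) = ∑ n ∈ B, f n :=
    Finset.sum_congr rfl fun n hn => if_neg (hB1 n hn).1
  rw [h3]
  have := norm_sub_le (∑ n ∈ A, f n + ∑ n ∈ B, f n) (∑ n ∈ A, f n)
  rw [add_sub_cancel_left] at this
  linarith

/-- Flat vectors are bounded by their sup-norm times the size of their support. -/
theorem of_flat {s : ℝ} (hs : 0 ≤ s) (hfs : ∀ n, ‖f n‖ ≤ s) {A : Finset ℕ}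
    (hA : ∀ n ∉ A, f n = 0) : IsGreedyBound f (A.card * s) := by
  have hsub : ∀ t : ℝ, 0 < t → ∀ B : Finset ℕ, (∀ n ∈ B, t ≤ ‖f n‖) → B ⊆ A := by
    intro t ht B hB n hn
    by_contra hnA
    have := hB n hn
    rw [hA n hnA, norm_zero] at this
    linarith
  refine ⟨by positivity, fun t ht B hB => ?_, fun t ht B hB _ => ?_⟩
  · have h1 := Finset.card_le_card (hsub t ht B hB)
    rcases B.eq_empty_or_nonempty with rfl | ⟨b, hb⟩
    · simp; positivity
    have := (hB b hb).trans (hfs b)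
    gcongr
  · refine (norm_sum_le_of_le B fun n _ => hfs n).trans ?_
    rw [Finset.sum_const, nsmul_eq_mul]
    gcongr
    exact hsub t ht B hB

end IsGreedyBound

/-! ### Two cancelling copies of a sequence -/

section TwoCopies

/-- The sequence taking the values `d i` at the odd positions `2 i + 1`, the values `-d i` at the
even positions `2 g i`, and vanishing elsewhere. -/
noncomputable def twoCopies (𝕜 : Type u) [RCLike 𝕜] (g : ℕ → ℕ) (d : ℕ → ℝ) (n : ℕ) : 𝕜 :=
  if n % 2 = 1 then (d (n / 2) : 𝕜) else -((Function.extend g d 0 (n / 2) : ℝ) : 𝕜)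

variable {𝕜 : Type u} [RCLike 𝕜] {g : ℕ → ℕ} {d : ℕ → ℝ}

@[simp]
theorem twoCopies_odd (g : ℕ → ℕ) (d : ℕ → ℝ) (i : ℕ) : twoCopies 𝕜 g d (2 * i + 1) = d i := by
  have h1 : (2 * i + 1) % 2 = 1 := by omega
  have h2 : (2 * i + 1) / 2 = i := by omega
  simp [twoCopies, h1, h2]

theorem twoCopies_even (g : ℕ → ℕ) (d : ℕ → ℝ) (i : ℕ) :
    twoCopies 𝕜 g d (2 * i) = -((Function.extend g d 0 i : ℝ) : 𝕜) := by
  simp [twoCopies]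

theorem twoCopies_even_apply (hg : g.Injective) (d : ℕ → ℝ) (i : ℕ) :
    twoCopies 𝕜 g d (2 * g i) = -(d i : 𝕜) := by
  rw [twoCopies_even, hg.extend_apply]

theorem twoCopies_eq_zero {n : ℕ} (h1 : ∀ i, 2 * i + 1 ≠ n) (h2 : ∀ i, 2 * g i ≠ n) :
    twoCopies 𝕜 g d n = 0 := by
  have h3 : n % 2 = 0 := by
    have := h1 (n / 2)
    omega
  obtain ⟨k, rfl⟩ : ∃ k, n = 2 * k := ⟨n / 2, by omega⟩
  rw [twoCopies_even, Function.extend_apply']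
  · simp
  · rintro ⟨i, hi⟩
    exact h2 i (by rw [hi])

theorem twoCopies_sub (hg : g.Injective) (d e : ℕ → ℝ) :
    twoCopies 𝕜 g (d - e) = twoCopies 𝕜 g d - twoCopies 𝕜 g e := by
  funext n
  rw [Pi.sub_apply]
  rcases em (∃ i, 2 * i + 1 = n) with ⟨i, rfl⟩ | h1
  · simp
  rcases em (∃ i, 2 * g i = n) with ⟨i, rfl⟩ | h2
  · simp only [twoCopies_even_apply hg, Pi.sub_apply]
    push_cast
    ring
  push Not at h1 h2
  simp [twoCopies_eq_zero h1 h2]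

theorem sum_twoCopies (hg : g.Injective) {A : Finset ℕ} (hA : ∀ n ∈ A, twoCopies 𝕜 g d n ≠ 0) :
    ∃ I J : Finset ℕ, (∀ i, i ∈ I ↔ 2 * i + 1 ∈ A) ∧ (∀ i, i ∈ J ↔ 2 * g i ∈ A) ∧
      A.card = I.card + J.card ∧
      ∑ n ∈ A, twoCopies 𝕜 g d n = ∑ i ∈ I, (d i : 𝕜) - ∑ i ∈ J, (d i : 𝕜) := by
  classical
  have ha : Function.Injective fun i : ℕ => 2 * i + 1 := fun i j h => by simpa using h
  have hb : Function.Injective fun i : ℕ => 2 * g i := fun i j h => hg (by simpa using h)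
  set I := A.preimage _ ha.injOn with hI
  set J := A.preimage _ hb.injOn with hJ
  have hIm : ∀ i, i ∈ I ↔ 2 * i + 1 ∈ A := by simp [hI]
  have hJm : ∀ i, i ∈ J ↔ 2 * g i ∈ A := by simp [hJ]
  have hA' : A = I.image (fun i : ℕ => 2 * i + 1) ∪ J.image (fun i : ℕ => 2 * g i) := by
    ext n
    simp only [Finset.mem_union, Finset.mem_image, hIm, hJm]
    refine ⟨fun hn => ?_, ?_⟩
    · by_contra! hcon
      exact hA n hn (twoCopies_eq_zero (fun i hi => hcon.1 i (hi ▸ hn) hi)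
        fun i hi => hcon.2 i (hi ▸ hn) hi)
    · rintro (⟨i, hi, rfl⟩ | ⟨i, hi, rfl⟩) <;> assumption
  have hdisj : Disjoint (I.image fun i : ℕ => 2 * i + 1) (J.image fun i : ℕ => 2 * g i) := by
    rw [Finset.disjoint_left]
    simp only [Finset.mem_image]
    rintro _ ⟨i, _, rfl⟩ ⟨j, _, hj⟩
    omega
  refine ⟨I, J, hIm, hJm, ?_, ?_⟩
  · rw [hA', Finset.card_union_of_disjoint hdisj, Finset.card_image_of_injective _ ha,
      Finset.card_image_of_injective _ hb]
  · rw [hA', Finset.sum_union hdisj, Finset.sum_image ha.injOn, Finset.sum_image hb.injOn]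
    simp [twoCopies_even_apply hg, sub_eq_add_neg]

/-- If `t ≤ d i` then `i + 1 ≤ C / t`, which leaves at most `C / t` indices. -/
theorem card_mul_le_of_le_div {C : ℝ} (hd : ∀ i, d i ≤ C / (i + 1)) {t : ℝ} (ht : 0 < t)
    (hC : 0 ≤ C) {I : Finset ℕ} (hI : ∀ i ∈ I, t ≤ d i) : I.card * t ≤ C := by
  have h1 : I ⊆ Finset.range ⌊C / t⌋₊ := by
    intro i hi
    have h2 := (hI i hi).trans (hd i)
    rw [le_div_iff₀ (by positivity)] at h2
    rw [Finset.mem_range, ← Nat.succ_le_iff]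
    refine Nat.le_floor ?_
    rw [le_div_iff₀ ht]
    push_cast
    linarith
  have h2 := Finset.card_le_card h1
  rw [Finset.card_range] at h2
  have h3 : (I.card : ℝ) ≤ C / t :=
    (Nat.cast_le.2 h2).trans (Nat.floor_le (by positivity))
  rwa [le_div_iff₀ ht] at h3

/-- By cancellation of the two copies, only the ties contribute to the greedy sums. -/
theorem isGreedyBound_twoCopies (hg : g.Injective) (hd0 : ∀ i, 0 ≤ d i) {C : ℝ} (hC : 0 ≤ C)
    (hd : ∀ i, d i ≤ C / (i + 1)) : IsGreedyBound (twoCopies 𝕜 g d) (2 * C) := by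
  classical
  have ha : ∀ i, ‖twoCopies 𝕜 g d (2 * i + 1)‖ = d i := fun i => by
    rw [twoCopies_odd, RCLike.norm_ofReal, abs_of_nonneg (hd0 i)]
  have hb : ∀ i, ‖twoCopies 𝕜 g d (2 * g i)‖ = d i := fun i => by
    rw [twoCopies_even_apply hg, norm_neg, RCLike.norm_ofReal, abs_of_nonneg (hd0 i)]
  refine ⟨by positivity, fun t ht A hA => ?_, fun t ht A hA hA' => ?_⟩ <;>
  obtain ⟨I, J, hI, hJ, hcard, hsum⟩ :=
    sum_twoCopies hg fun n hn => norm_pos_iff.1 (ht.trans_le (hA n hn)) <;>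
  have hI1 : ∀ i ∈ I, t ≤ d i := fun i hi => ha i ▸ hA _ ((hI i).1 hi) <;>
  have hJ1 : ∀ i ∈ J, t ≤ d i := fun i hi => hb i ▸ hA _ ((hJ i).1 hi) <;>
  have hI2 := card_mul_le_of_le_div hd ht hC hI1 <;>
  have hJ2 := card_mul_le_of_le_div hd ht hC hJ1
  · rw [hcard]
    push_cast
    linarith
  · have hI3 : ∀ i, i ∉ I → d i ≤ t := fun i hi => ha i ▸ hA' _ fun h => hi ((hI i).2 h)
    have hJ3 : ∀ i, i ∉ J → d i ≤ t := fun i hi => hb i ▸ hA' _ fun h => hi ((hJ i).2 h)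
    -- For `i ∈ I \ J` only the odd copy lies in `A`, so `d i` is squeezed to the tie value `t`. The
    -- set `J \ I` is symmetric.
    have h1 : ‖∑ i ∈ I \ J, (d i : 𝕜)‖ ≤ I.card * t := by
      refine (norm_sum_le_of_le (I \ J) (f := fun i => (d i : 𝕜)) fun i hi =>
        (?_ : ‖(d i : 𝕜)‖ ≤ t)).trans ?_
      · rw [RCLike.norm_ofReal, abs_of_nonneg (hd0 i)]
        exact hJ3 i (Finset.mem_sdiff.1 hi).2
      · rw [Finset.sum_const, nsmul_eq_mul]
        gcongr
        exact Finset.sdiff_subset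
    have h2 : ‖∑ i ∈ J \ I, (d i : 𝕜)‖ ≤ J.card * t := by
      refine (norm_sum_le_of_le (J \ I) (f := fun i => (d i : 𝕜)) fun i hi =>
        (?_ : ‖(d i : 𝕜)‖ ≤ t)).trans ?_
      · rw [RCLike.norm_ofReal, abs_of_nonneg (hd0 i)]
        exact hI3 i (Finset.mem_sdiff.1 hi).2
      · rw [Finset.sum_const, nsmul_eq_mul]
        gcongr
        exact Finset.sdiff_subset
    rw [hsum, ← Finset.sum_sdiff_sub_sum_sdiff]
    linarith [norm_sub_le (∑ i ∈ I \ J, (d i : 𝕜)) (∑ i ∈ J \ I, (d i : 𝕜))]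

/-- Below `2 * g k` lie the first `g k` positive entries but only the first `k` negative ones; a
fast growing `g` makes the difference large. -/
theorem sum_range_twoCopies (hg : StrictMono g) (d : ℕ → ℝ) (k : ℕ) :
    ∑ n ∈ Finset.range (2 * g k), twoCopies 𝕜 g d n =
      ((∑ i ∈ Finset.range (g k), d i - ∑ i ∈ Finset.range k, d i : ℝ) : 𝕜) := by
  have h1 : ∀ m, ∑ n ∈ Finset.range (2 * m), twoCopies 𝕜 g d n =
      ((∑ i ∈ Finset.range m, d i - ∑ i ∈ Finset.range m, Function.extend g d 0 i : ℝ) : 𝕜) := by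
    intro m
    induction m with
    | zero => simp
    | succ m ih =>
      rw [show 2 * (m + 1) = 2 * m + 1 + 1 by ring, Finset.sum_range_succ, Finset.sum_range_succ,
        ih, twoCopies_odd, twoCopies_even, Finset.sum_range_succ, Finset.sum_range_succ]
      push_cast
      ring
  have h2 : ∑ i ∈ Finset.range (g k), Function.extend g d 0 i = ∑ i ∈ Finset.range k, d i := by
    rw [← Finset.sum_subset (s₁ := (Finset.range k).image g), Finset.sum_image hg.injective.injOn]
    · simp [hg.injective.extend_apply]
    · intro n hn
      obtain ⟨i, hi, rfl⟩ := Finset.mem_image.1 hn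
      simpa using hg (Finset.mem_range.1 hi)
    · intro n hn hn'
      rw [Function.extend_apply']
      · rfl
      · rintro ⟨i, rfl⟩
        exact hn' (Finset.mem_image_of_mem g (by simpa [hg.lt_iff_lt] using hn))
  rw [h1, h2]

end TwoCopies

/-! ### A divergent series with small weak-`ℓ₁` tails -/

/-- The sequence `1 / ((k + 2) log (k + 2))`. -/
noncomputable def invMulLog (k : ℕ) : ℝ := 1 / ((k + 2) * Real.log (k + 2))

theorem log_two_le_log_add_two (k : ℕ) : Real.log 2 ≤ Real.log (k + 2) :=
  Real.log_le_log (by norm_num) (by linarith [(Nat.cast_nonneg k : (0 : ℝ) ≤ k)])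

theorem log_add_two_pos (k : ℕ) : 0 < Real.log ((k : ℝ) + 2) :=
  (Real.log_pos (by norm_num)).trans_le (log_two_le_log_add_two k)

theorem invMulLog_nonneg (k : ℕ) : 0 ≤ invMulLog k := by
  have := log_add_two_pos k
  unfold invMulLog
  positivity

theorem invMulLog_le_one (k : ℕ) : invMulLog k ≤ 1 := by
  have h1 := log_two_le_log_add_two k
  have h2 := Real.log_two_gt_d9
  have hk : (0 : ℝ) ≤ k := Nat.cast_nonneg k
  rw [invMulLog, div_le_one (by have := log_add_two_pos k; positivity)]
  nlinarith

/-- The tail from `m` on has weak-`ℓ₁` constant `1 / log (m + 2)`, which tends to zero. -/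
theorem invMulLog_le {m k : ℕ} (hmk : m ≤ k) :
    invMulLog k ≤ (1 / Real.log (m + 2)) / (k + 1) := by
  have h1 := log_add_two_pos m
  have h2 : Real.log (m + 2) ≤ Real.log (k + 2) :=
    Real.log_le_log (by positivity) (by gcongr)
  rw [invMulLog, div_div, mul_comm]
  gcongr
  · linarith
  · norm_num

/-- Two uses of `log x ≤ x - 1`. Telescoping then yields divergence of the series. -/
theorem log_log_sub_le (k : ℕ) :
    Real.log (Real.log ((k + 1 : ℕ) + 2)) - Real.log (Real.log (k + 2)) ≤ invMulLog k := by
  have h1 := log_add_two_pos k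
  have h2 := log_add_two_pos (k + 1)
  have h3 : (0 : ℝ) < k + 2 := by positivity
  have h4 : Real.log ((k + 1 : ℕ) + 2) - Real.log (k + 2) ≤ 1 / (k + 2) := by
    rw [← Real.log_div (by positivity) (by positivity)]
    refine (Real.log_le_sub_one_of_pos (by positivity)).trans (le_of_eq ?_)
    push_cast
    field_simp
    ring
  rw [← Real.log_div h2.ne' h1.ne']
  refine (Real.log_le_sub_one_of_pos (by positivity)).trans ?_
  rw [invMulLog, div_sub_one h1.ne', ← div_div]
  gcongr

theorem tendsto_sum_invMulLog :
    Tendsto (fun n => ∑ k ∈ Finset.range n, invMulLog k) atTop atTop := by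
  have h1 : ∀ n : ℕ, Real.log (Real.log (n + 2)) - Real.log (Real.log 2) ≤
      ∑ k ∈ Finset.range n, invMulLog k := by
    intro n
    have := Finset.sum_range_sub (fun k : ℕ => Real.log (Real.log (k + 2))) n
    simp only [Nat.cast_zero, zero_add] at this
    rw [← this]
    exact Finset.sum_le_sum fun k _ => log_log_sub_le k
  refine tendsto_atTop_mono h1 (tendsto_atTop_add_const_right _ _ ?_)
  exact Real.tendsto_log_atTop.comp (Real.tendsto_log_atTop.comp
    (tendsto_atTop_add_const_right _ _ tendsto_natCast_atTop_atTop))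

/-- There is a sequence which, in the greedy quasi-norm, is approximated by its truncations, while
its partial sums are unbounded. -/
theorem exists_unbounded_partial_sums (𝕜 : Type u) [RCLike 𝕜] :
    ∃ f : ℕ → 𝕜, (∀ ε : ℝ, 0 < ε → ∃ h : ℕ → 𝕜, (∃ s : Finset ℕ, ∀ n ∉ s, h n = 0) ∧
      IsGreedyBound (f - h) ε) ∧ ∀ C : ℝ, ∃ᶠ m in atTop, C < ‖∑ n ∈ Finset.range m, f n‖ := by
  -- The first `g k` terms sum to at least `2 * k`, while the first `k` sum to at most `k`; the
  -- surplus is at least `k`.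
  obtain ⟨g, hg, hgk⟩ := extraction_forall_of_eventually
    (fun k : ℕ => tendsto_sum_invMulLog.eventually_ge_atTop (2 * (k : ℝ)))
  refine ⟨twoCopies 𝕜 g invMulLog, fun ε hε => ?_, fun C => ?_⟩
  · have h1 : Tendsto (fun m : ℕ => 2 * (1 / Real.log ((m : ℝ) + 2))) atTop (𝓝 (2 * 0)) := by
      simp only [one_div]
      exact (tendsto_inv_atTop_zero.comp (Real.tendsto_log_atTop.comp
        (tendsto_atTop_add_const_right _ _ tendsto_natCast_atTop_atTop))).const_mul 2
    rw [mul_zero] at h1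
    obtain ⟨m, hm⟩ := (h1.eventually_lt_const hε).exists
    -- Both copies are cut at the same index `m`, so the remainder is again a `twoCopies` sequence
    -- and keeps its cancellation.
    set e : ℕ → ℝ := fun i => if i < m then invMulLog i else 0 with he
    refine ⟨twoCopies 𝕜 g e, ?_, ?_⟩
    · classical
      refine ⟨(Finset.range m).image (fun i => 2 * i + 1) ∪ (Finset.range m).image
        (fun i => 2 * g i), fun n hn => ?_⟩
      by_contra hn0
      apply hn
      by_contra hn'
      apply hn0
      by_cases h2 : ∃ i, 2 * i + 1 = n
      · obtain ⟨i, rfl⟩ := h2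
        have : ¬ i < m := fun hi => hn (Finset.mem_union_left _
          (Finset.mem_image_of_mem (fun i => 2 * i + 1) (Finset.mem_range.2 hi)))
        simp [he, this]
      by_cases h3 : ∃ i, 2 * g i = n
      · obtain ⟨i, rfl⟩ := h3
        have : ¬ i < m := fun hi => hn (Finset.mem_union_right _
          (Finset.mem_image_of_mem (fun i => 2 * g i) (Finset.mem_range.2 hi)))
        simp [he, this, twoCopies_even_apply hg.injective]
      push Not at h2 h3
      exact twoCopies_eq_zero h2 h3
    · rw [← twoCopies_sub hg.injective]
      have hpos := log_add_two_pos m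
      refine (isGreedyBound_twoCopies hg.injective (C := 1 / Real.log (m + 2)) (fun i => ?_)
        (by positivity) fun i => ?_).mono hm.le
      · by_cases hi : i < m
        · simp [he, hi]
        · simpa [he, hi] using invMulLog_nonneg i
      · by_cases hi : i < m
        · simp only [Pi.sub_apply, he, hi, if_true, sub_self]
          positivity
        · simpa only [Pi.sub_apply, he, hi, if_false, sub_zero] using invMulLog_le (not_lt.1 hi)
  · rw [frequently_atTop]
    intro a
    obtain ⟨k, hk⟩ := exists_nat_gt C
    set l := max a k
    have hl : l ≤ g l := hg.id_le l
    refine ⟨2 * g l, by have := le_max_left a k; omega, ?_⟩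
    have h1 : ∑ i ∈ Finset.range l, invMulLog i ≤ l := by
      simpa using Finset.sum_le_sum fun i (_ : i ∈ Finset.range l) => invMulLog_le_one i
    have h2 := hgk l
    have h3 : (k : ℝ) ≤ l := by exact_mod_cast le_max_right a k
    rw [sum_range_twoCopies hg, RCLike.norm_ofReal]
    refine lt_of_lt_of_le ?_ (le_abs_self _)
    linarith

/-! ### The space and its quasi-norm -/

/-- The sequences that can be approximated, in the greedy quasi-norm, by finitely supported ones. -/
def greedySubmodule (𝕜 : Type u) [RCLike 𝕜] : Submodule 𝕜 (ℕ → 𝕜) where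
  carrier := {f | ∀ ε : ℝ, 0 < ε → ∃ h : ℕ → 𝕜, (∃ s : Finset ℕ, ∀ n ∉ s, h n = 0) ∧
    IsGreedyBound (f - h) ε}
  zero_mem' ε hε := ⟨0, ⟨∅, by simp⟩, by simpa using IsGreedyBound.zero.mono hε.le⟩
  add_mem' {f g} hf hg ε hε := by
    classical
    obtain ⟨f', ⟨s, hs⟩, hf'⟩ := hf (ε / 14) (by positivity)
    obtain ⟨g', ⟨t, ht⟩, hg'⟩ := hg (ε / 14) (by positivity)
    refine ⟨f' + g', ⟨s ∪ t, fun n hn => ?_⟩, ?_⟩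
    · rw [Finset.mem_union, not_or] at hn
      simp [hs n hn.1, ht n hn.2]
    · rw [add_sub_add_comm]
      exact (hf'.add hg').mono (by linarith)
  smul_mem' c f hf ε hε := by
    rcases eq_or_ne c 0 with rfl | hc
    · exact ⟨0, ⟨∅, by simp⟩, by simpa using IsGreedyBound.zero.mono hε.le⟩
    have hc' := norm_pos_iff.2 hc
    obtain ⟨f', ⟨s, hs⟩, hf'⟩ := hf (ε / ‖c‖) (by positivity)
    refine ⟨c • f', ⟨s, fun n hn => by simp [hs n hn]⟩, ?_⟩
    rw [← smul_sub]
    exact (hf'.smul hc).mono (by rw [mul_div_cancel₀ _ hc'.ne'])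

/-- The space of sequences approximable in the greedy quasi-norm by finitely supported ones. -/
def GreedySpace (𝕜 : Type u) [RCLike 𝕜] : Type u := ↥(greedySubmodule 𝕜)

namespace GreedySpace

variable {𝕜 : Type u} [RCLike 𝕜]

instance : AddCommGroup (GreedySpace 𝕜) := inferInstanceAs (AddCommGroup ↥(greedySubmodule 𝕜))

instance : Module 𝕜 (GreedySpace 𝕜) := inferInstanceAs (Module 𝕜 ↥(greedySubmodule 𝕜))

/-- The sequence underlying an element of the space. -/
def toSeq : GreedySpace 𝕜 →ₗ[𝕜] ℕ → 𝕜 := (greedySubmodule 𝕜).subtype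

theorem toSeq_injective : Function.Injective (toSeq (𝕜 := 𝕜)) := Subtype.val_injective

theorem exists_toSeq_eq {f : ℕ → 𝕜} (hf : f ∈ greedySubmodule 𝕜) : ∃ x, toSeq x = f :=
  ⟨⟨f, hf⟩, rfl⟩

theorem toSeq_mem (x : GreedySpace 𝕜) : toSeq x ∈ greedySubmodule 𝕜 := x.2

theorem mem_of_support {f : ℕ → 𝕜} {s : Finset ℕ} (hf : ∀ n ∉ s, f n = 0) :
    f ∈ greedySubmodule 𝕜 := fun ε hε =>
  ⟨f, ⟨s, hf⟩, by simpa using IsGreedyBound.zero.mono hε.le⟩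

theorem exists_isGreedyBound (x : GreedySpace 𝕜) : ∃ C, IsGreedyBound (toSeq x) C := by
  obtain ⟨h, ⟨s, hs⟩, hx⟩ := toSeq_mem x 1 one_pos
  have h1 : IsGreedyBound h _ := IsGreedyBound.of_flat (s := ∑ n ∈ s, ‖h n‖)
    (Finset.sum_nonneg fun n _ => norm_nonneg _) (fun n => by
      by_cases hn : n ∈ s
      · exact Finset.single_le_sum (f := fun n => ‖h n‖) (fun n _ => norm_nonneg _) hn
      · rw [hs n hn, norm_zero]
        exact Finset.sum_nonneg fun n _ => norm_nonneg _) hs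
  exact ⟨_, by simpa using hx.add h1⟩

/-- The greedy quasi-norm: the least greedy bound. -/
noncomputable def gauge (x : GreedySpace 𝕜) : ℝ := sInf {C | IsGreedyBound (toSeq x) C}

theorem gauge_le {x : GreedySpace 𝕜} {C : ℝ} (h : IsGreedyBound (toSeq x) C) : gauge x ≤ C :=
  csInf_le ⟨0, fun _ hC => hC.nonneg⟩ h

/-- The infimum is attained, since every condition is a lower bound on `C`. -/
theorem isGreedyBound_gauge (x : GreedySpace 𝕜) : IsGreedyBound (toSeq x) (gauge x) where
  nonneg := le_csInf (exists_isGreedyBound x) fun _ hC => hC.nonneg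
  card_mul_le t ht A hA := le_csInf (exists_isGreedyBound x) fun _ hC => hC.card_mul_le t ht A hA
  norm_sum_le t ht A hA hA' :=
    le_csInf (exists_isGreedyBound x) fun _ hC => hC.norm_sum_le t ht A hA hA'

theorem gauge_le_iff {x : GreedySpace 𝕜} {C : ℝ} : gauge x ≤ C ↔ IsGreedyBound (toSeq x) C :=
  ⟨fun h => (isGreedyBound_gauge x).mono h, gauge_le⟩

theorem gauge_nonneg (x : GreedySpace 𝕜) : 0 ≤ gauge x := (isGreedyBound_gauge x).nonneg

@[simp]
theorem gauge_zero : gauge (0 : GreedySpace 𝕜) = 0 :=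
  le_antisymm (gauge_le (by simpa using IsGreedyBound.zero)) (gauge_nonneg _)

theorem norm_toSeq_le (x : GreedySpace 𝕜) (n : ℕ) : ‖toSeq x n‖ ≤ gauge x :=
  (isGreedyBound_gauge x).norm_apply_le n

theorem gauge_smul (c : 𝕜) (x : GreedySpace 𝕜) : gauge (c • x) = ‖c‖ * gauge x := by
  have key : ∀ (c : 𝕜) (x : GreedySpace 𝕜), c ≠ 0 → gauge (c • x) ≤ ‖c‖ * gauge x :=
    fun c x hc => gauge_le (by simpa using (isGreedyBound_gauge x).smul hc)
  rcases eq_or_ne c 0 with rfl | hc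
  · simp
  refine le_antisymm (key c x hc) ?_
  have h := key c⁻¹ (c • x) (inv_ne_zero hc)
  rwa [inv_smul_smul₀ hc, norm_inv, le_inv_mul_iff₀ (norm_pos_iff.2 hc)] at h

theorem gauge_neg (x : GreedySpace 𝕜) : gauge (-x) = gauge x := by
  simpa using gauge_smul (-1 : 𝕜) x

theorem gauge_add_le (x y : GreedySpace 𝕜) : gauge (x + y) ≤ 7 * (gauge x + gauge y) :=
  gauge_le (by simpa using (isGreedyBound_gauge x).add (isGreedyBound_gauge y))

theorem gauge_pos {x : GreedySpace 𝕜} (hx : x ≠ 0) : 0 < gauge x := by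
  by_contra! h
  refine hx (toSeq_injective ?_)
  funext n
  simpa using (norm_toSeq_le x n).trans h

/-! ### Topology and completeness -/

/-- The balls of the greedy quasi-norm form a basis of neighbourhoods of the origin. -/
noncomputable abbrev filterBasis (𝕜 : Type u) [RCLike 𝕜] : AddGroupFilterBasis (GreedySpace 𝕜) where
  sets := {U | ∃ r : ℝ, 0 < r ∧ U = {x | gauge x ≤ r}}
  nonempty := ⟨_, 1, one_pos, rfl⟩
  inter_sets := by
    rintro _ _ ⟨r, hr, rfl⟩ ⟨s, hs, rfl⟩
    exact ⟨_, ⟨min r s, lt_min hr hs, rfl⟩, fun x (hx : gauge x ≤ min r s) =>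
      ⟨hx.trans (min_le_left _ _), hx.trans (min_le_right _ _)⟩⟩
  zero' := by
    rintro _ ⟨r, hr, rfl⟩
    simpa using hr.le
  add' := by
    rintro _ ⟨r, hr, rfl⟩
    refine ⟨_, ⟨r / 14, by positivity, rfl⟩, ?_⟩
    rintro _ ⟨x, hx, y, hy, rfl⟩
    have := gauge_add_le x y
    simp only [Set.mem_ofPred_eq] at hx hy ⊢
    linarith
  neg' := by
    rintro _ ⟨r, hr, rfl⟩
    exact ⟨_, ⟨r, hr, rfl⟩, fun x hx => by simpa [gauge_neg] using hx⟩
  conj' := by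
    rintro x₀ _ ⟨r, hr, rfl⟩
    exact ⟨_, ⟨r, hr, rfl⟩, fun x hx => by simpa using hx⟩

noncomputable instance : TopologicalSpace (GreedySpace 𝕜) := (filterBasis 𝕜).topology

instance : IsTopologicalAddGroup (GreedySpace 𝕜) := (filterBasis 𝕜).isTopologicalAddGroup

noncomputable instance : UniformSpace (GreedySpace 𝕜) :=
  IsTopologicalAddGroup.rightUniformSpace (GreedySpace 𝕜)

instance : IsUniformAddGroup (GreedySpace 𝕜) := isUniformAddGroup_of_addCommGroup

theorem nhds_zero_hasBasis : (𝓝 (0 : GreedySpace 𝕜)).HasBasis (fun r : ℝ => 0 < r)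
    (fun r => {x | gauge x ≤ r}) :=
  (filterBasis 𝕜).nhds_zero_hasBasis.to_hasBasis
    (by rintro _ ⟨r, hr, rfl⟩; exact ⟨r, hr, le_rfl⟩)
    fun r hr => ⟨_, ⟨r, hr, rfl⟩, le_rfl⟩

theorem tendsto_iff {α : Type*} {l : Filter α} {u : α → GreedySpace 𝕜} {x : GreedySpace 𝕜} :
    Tendsto u l (𝓝 x) ↔ ∀ ε : ℝ, 0 < ε → ∀ᶠ a in l, gauge (u a - x) ≤ ε := by
  rw [← tendsto_sub_nhds_zero_iff, nhds_zero_hasBasis.tendsto_right_iff]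
  rfl

/-- Reduces completeness to Cauchy sequences. -/
instance : (𝓝 (0 : GreedySpace 𝕜)).IsCountablyGenerated := by
  have : 𝓝 (0 : GreedySpace 𝕜) = comap gauge (𝓝 0) := by
    refine nhds_zero_hasBasis.eq_of_same_basis ?_
    have := (Metric.nhds_basis_closedBall (x := (0 : ℝ))).comap (gauge (𝕜 := 𝕜))
    refine this.congr (fun _ => Iff.rfl) fun r _ => ?_
    ext x
    simp [abs_of_nonneg (gauge_nonneg x)]
  rw [this]
  infer_instance

theorem cauchySeq_iff {u : ℕ → GreedySpace 𝕜} :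
    CauchySeq u ↔ ∀ ε : ℝ, 0 < ε → ∃ N, ∀ i, N ≤ i → ∀ j, N ≤ j → gauge (u j - u i) ≤ ε := by
  have h := nhds_zero_hasBasis.comap fun p : GreedySpace 𝕜 × GreedySpace 𝕜 => p.2 - p.1
  rw [← uniformity_eq_comap_nhds_zero] at h
  rw [h.cauchySeq_iff]
  rfl

instance : CompleteSpace (GreedySpace 𝕜) := by
  have := IsUniformAddGroup.uniformity_countably_generated (α := GreedySpace 𝕜)
  refine UniformSpace.complete_of_cauchySeq_tendsto fun u hu => ?_
  rw [cauchySeq_iff] at hu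
  have hpt : ∀ n, ∃ a, Tendsto (fun i => toSeq (u i) n) atTop (𝓝 a) := by
    intro n
    refine cauchySeq_tendsto_of_complete (Metric.cauchySeq_iff.2 fun ε hε => ?_)
    obtain ⟨N, hN⟩ := hu (ε / 2) (by positivity)
    refine ⟨N, fun i hi j hj => ?_⟩
    rw [dist_comm, dist_eq_norm, ← Pi.sub_apply, ← map_sub]
    exact ((norm_toSeq_le _ n).trans (hN i hi j hj)).trans_lt (by linarith)
  choose f hf using hpt
  have hunif : ∀ ε : ℝ, 0 < ε → ∃ N, ∀ j, N ≤ j → ∀ n, ‖f n - toSeq (u j) n‖ ≤ ε := by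
    intro ε hε
    obtain ⟨N, hN⟩ := hu ε hε
    refine ⟨N, fun j hj n => ?_⟩
    refine le_of_tendsto ((hf n).sub_const _).norm ?_
    filter_upwards [eventually_ge_atTop N] with i hi
    rw [← Pi.sub_apply, ← map_sub]
    exact (norm_toSeq_le _ n).trans (hN j hj i hi)
  have hlim : ∀ ε : ℝ, 0 < ε → ∃ N, ∀ i, N ≤ i → IsGreedyBound (f - toSeq (u i)) ε := by
    intro ε hε
    obtain ⟨N, hN⟩ := hu (ε / 5) (by positivity)
    refine ⟨N, fun i hi => ?_⟩
    -- The differences `u j - u i` have bound `ε / 5` and converge uniformly to `f - u i`, so the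
    -- bound survives in the limit up to the factor 5.
    have h1 : IsGreedyBound (f - toSeq (u i)) (5 * (ε / 5)) := by
      refine IsGreedyBound.of_uniform_approx (by positivity) fun δ hδ => ?_
      obtain ⟨M, hM⟩ := hunif δ hδ
      refine ⟨toSeq (u (max M N) - u i),
        gauge_le_iff.1 (hN i hi _ (le_max_right _ _)), fun n => ?_⟩
      simpa using hM _ (le_max_left M N) n
    exact h1.mono (by linarith)
  have hmem : f ∈ greedySubmodule 𝕜 := by
    intro ε hε
    obtain ⟨N, hN⟩ := hlim (ε / 14) (by positivity)
    obtain ⟨h, hs, hh⟩ := toSeq_mem (u N) (ε / 14) (by positivity)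
    refine ⟨h, hs, ?_⟩
    have := (hN N le_rfl).add hh
    rw [sub_add_sub_cancel] at this
    exact this.mono (by linarith)
  obtain ⟨x, rfl⟩ := exists_toSeq_eq hmem
  refine ⟨x, tendsto_iff.2 fun ε hε => ?_⟩
  obtain ⟨N, hN⟩ := hlim ε hε
  filter_upwards [eventually_ge_atTop N] with i hi
  rw [← neg_sub, gauge_neg, gauge_le_iff, map_sub]
  exact hN i hi

theorem isQuasiBanachSpace : IsQuasiBanachSpace 𝕜 (gauge (𝕜 := 𝕜)) where
  nonneg := gauge_nonneg
  pos _ := gauge_pos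
  smul := gauge_smul
  add_le := ⟨7, gauge_add_le⟩
  nhds_zero := nhds_zero_hasBasis
  complete := inferInstance

/-! ### The unit vector basis and its greedy properties -/

/-- The coordinate functionals. -/
noncomputable def coord (n : ℕ) : GreedySpace 𝕜 →L[𝕜] 𝕜 where
  toLinearMap := LinearMap.proj n ∘ₗ toSeq
  cont := by
    refine continuous_of_continuousAt_zero (LinearMap.proj n ∘ₗ toSeq : GreedySpace 𝕜 →ₗ[𝕜] 𝕜) ?_
    rw [ContinuousAt, map_zero, nhds_zero_hasBasis.tendsto_iff Metric.nhds_basis_closedBall]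
    exact fun r hr => ⟨r, hr, fun x hx => by simpa using (norm_toSeq_le x n).trans hx⟩

@[simp]
theorem coord_apply (n : ℕ) (x : GreedySpace 𝕜) : coord n x = toSeq x n := rfl

/-- The unit vectors. -/
def unitVec (n : ℕ) : GreedySpace 𝕜 :=
  ⟨Pi.single n 1, mem_of_support (s := {n}) fun k hk => by
    rw [Pi.single_eq_of_ne (by simpa using hk)]⟩

theorem toSeq_unitVec (n : ℕ) : toSeq (unitVec n : GreedySpace 𝕜) = Pi.single n 1 := rfl

/-- The unit vector system. -/
noncomputable def unitSystem (𝕜 : Type u) [RCLike 𝕜] : MinimalSystem 𝕜 (GreedySpace 𝕜) where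
  vec := unitVec
  coord := coord
  biorthogonal n k := by simp [toSeq_unitVec, Pi.single_apply]

theorem toSeq_sum_smul_unitVec (A : Finset ℕ) (a : ℕ → 𝕜) (k : ℕ) :
    toSeq (∑ n ∈ A, a n • unitVec n) k = if k ∈ A then a k else 0 := by
  simp [map_sum, toSeq_unitVec, Pi.single_apply]

theorem toSeq_proj (A : Finset ℕ) (x : GreedySpace 𝕜) (k : ℕ) :
    toSeq ((unitSystem 𝕜).proj A x) k = if k ∈ A then toSeq x k else 0 :=
  toSeq_sum_smul_unitVec A (toSeq x) k

theorem toSeq_sub_proj (A : Finset ℕ) (x : GreedySpace 𝕜) :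
    toSeq (x - (unitSystem 𝕜).proj A x) = fun k => if k ∈ A then 0 else toSeq x k := by
  funext k
  rw [map_sub, Pi.sub_apply, toSeq_proj]
  split_ifs <;> simp

theorem isMarkushevichBasis : (unitSystem 𝕜).IsMarkushevichBasis := by
  refine ⟨fun x => ?_, fun x y h => toSeq_injective h⟩
  rw [mem_closure_iff_nhds]
  intro U hU
  have h1 : Tendsto (fun y : GreedySpace 𝕜 => x + y) (𝓝 0) (𝓝 x) := by
    simpa using (continuous_const_add x).tendsto 0
  obtain ⟨r, hr, hrU⟩ := nhds_zero_hasBasis.mem_iff.1 (h1 hU)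
  obtain ⟨h, ⟨s, hs⟩, hh⟩ := toSeq_mem x r hr
  have h2 : toSeq (∑ n ∈ s, h n • unitVec n) = h := by
    funext k
    rw [toSeq_sum_smul_unitVec]
    split_ifs with hk
    exacts [rfl, (hs k hk).symm]
  refine ⟨∑ n ∈ s, h n • unitVec n, ?_, Submodule.sum_mem _ fun n _ => Submodule.smul_mem _ _
    (Submodule.subset_span ⟨n, rfl⟩)⟩
  have h3 : (∑ n ∈ s, h n • unitVec n) - x ∈ {y : GreedySpace 𝕜 | gauge y ≤ r} := by
    rw [Set.mem_ofPred_eq, ← neg_sub, gauge_neg, gauge_le_iff, map_sub, h2]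
    exact hh
  simpa using hrU h3

theorem gauge_unitVec (n : ℕ) : gauge (unitVec n : GreedySpace 𝕜) = 1 := by
  refine le_antisymm (gauge_le ?_) ?_
  · have := IsGreedyBound.of_flat (f := (Pi.single n 1 : ℕ → 𝕜)) (s := 1) zero_le_one
      (fun k => by rw [Pi.single_apply]; split_ifs <;> simp) (A := {n})
      fun k hk => Pi.single_eq_of_ne (by simpa using hk) _
    simpa [toSeq_unitVec] using this
  · simpa [toSeq_unitVec] using norm_toSeq_le (unitVec n : GreedySpace 𝕜) n

theorem isWBasis : (unitSystem 𝕜).IsWBasis gauge := by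
  refine ⟨isMarkushevichBasis.1, ⟨1, 1, one_pos, fun n => ?_⟩, 1, fun n x => ?_⟩
  · exact ⟨(gauge_unitVec n).ge, (gauge_unitVec n).le⟩
  · have h : (unitSystem 𝕜).proj {n} x = toSeq x n • unitVec n := Finset.sum_singleton _ _
    rw [h, gauge_smul, gauge_unitVec, mul_one, one_mul]
    exact norm_toSeq_le x n

theorem gauge_sub_proj_le {x : GreedySpace 𝕜} {A : Finset ℕ}
    (hA : (unitSystem 𝕜).IsGreedySet x A) :
    gauge (x - (unitSystem 𝕜).proj A x) ≤ 2 * gauge x := by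
  rw [gauge_le_iff, toSeq_sub_proj]
  exact (isGreedyBound_gauge x).sub_greedy hA

theorem isQuasiGreedyBasis : (unitSystem 𝕜).IsQuasiGreedyBasis gauge :=
  ⟨isWBasis, 2, fun x A hx hA => (gauge_sub_proj_le hA).trans (by linarith)⟩

theorem isAlmostGreedyBasis : (unitSystem 𝕜).IsAlmostGreedyBasis gauge := by
  classical
  refine ⟨isWBasis, 21, by norm_num, fun x A B hA hBA => ?_⟩
  set y := x - (unitSystem 𝕜).proj B x with hy
  have hyk : ∀ k, toSeq y k = if k ∈ B then 0 else toSeq x k := fun k => by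
    rw [hy, toSeq_sub_proj]
  have hAB : (unitSystem 𝕜).IsGreedySet y (A \ B) := by
    intro n hn k hk
    rw [Finset.mem_sdiff] at hn hk
    change ‖toSeq y k‖ ≤ ‖toSeq y n‖
    rw [hyk, hyk, if_neg hn.2]
    split_ifs with hkB
    · simp
    · exact hA n hn.1 k fun h => hk ⟨h, hkB⟩
  have hcard : (B \ A).card ≤ (A \ B).card := Finset.card_sdiff_le_card_sdiff_iff.2 hBA
  -- The first summand is `y` minus a greedy projection, of gauge at most `2 * gauge y`; the second
  -- is at most `gauge y`. With the quasi-triangle constant 7 this gives 21.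
  have hsplit : x - (unitSystem 𝕜).proj A x =
      (y - (unitSystem 𝕜).proj (A \ B) y) + (unitSystem 𝕜).proj (B \ A) x := by
    refine toSeq_injective (funext fun k => ?_)
    rw [map_add, Pi.add_apply, toSeq_sub_proj, toSeq_sub_proj, toSeq_proj]
    simp only [hyk, Finset.mem_sdiff]
    by_cases h1 : k ∈ A <;> by_cases h2 : k ∈ B <;> simp [h1, h2]
  -- The least modulus of `x` on `A \ B` dominates `x` on `B \ A`, a set no larger than `A \ B`. On
  -- `A \ B` the vector `y` agrees with `x`, so its weak-`ℓ₁` size pays for the flat part.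
  have hflat : gauge ((unitSystem 𝕜).proj (B \ A) x) ≤ gauge y := by
    rcases (A \ B).eq_empty_or_nonempty with he | hne
    · have : B \ A = ∅ := by simpa [he] using hcard
      simp [this, MinimalSystem.proj, gauge_nonneg]
    obtain ⟨m, hm, hmin⟩ := (A \ B).exists_min_image (fun n => ‖toSeq x n‖) hne
    have h1 : ((A \ B).card : ℝ) * ‖toSeq x m‖ ≤ gauge y := by
      rcases (norm_nonneg (toSeq x m)).eq_or_lt with h0 | h0
      · rw [← h0, mul_zero]
        exact gauge_nonneg y
      · refine (isGreedyBound_gauge y).card_mul_le _ h0 _ fun n hn => ?_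
        rw [hyk, if_neg (Finset.mem_sdiff.1 hn).2]
        exact hmin n hn
    have h2 := IsGreedyBound.of_flat (f := toSeq ((unitSystem 𝕜).proj (B \ A) x))
      (norm_nonneg (toSeq x m)) (fun k => by
        rw [toSeq_proj]
        split_ifs with hk
        · exact hA m (Finset.mem_sdiff.1 hm).1 k (Finset.mem_sdiff.1 hk).2
        · simp) (A := B \ A) fun k hk => by rw [toSeq_proj, if_neg hk]
    refine (gauge_le h2).trans (le_trans ?_ h1)
    gcongr
  have h1 := gauge_sub_proj_le hAB
  have h2 := gauge_add_le (y - (unitSystem 𝕜).proj (A \ B) y) ((unitSystem 𝕜).proj (B \ A) x)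
  rw [hsplit]
  linarith

theorem isSymmetric : (unitSystem 𝕜).IsSymmetric gauge := by
  refine ⟨1, le_rfl, fun π a => ?_⟩
  rw [one_mul, gauge_le_iff]
  have h : toSeq (a.sum fun n t => t • (unitSystem 𝕜).vec n) =
      toSeq (a.sum fun n t => t • (unitSystem 𝕜).vec (π n)) ∘ π := by
    funext k
    simp [Finsupp.sum, unitSystem, map_sum, toSeq_unitVec, Pi.single_apply]
  rw [h]
  exact (isGreedyBound_gauge _).comp_perm π

/-! ### Failure of every ordering -/

theorem not_isSchauderBasis (π : Equiv.Perm ℕ) :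
    ¬ IsSchauderBasis 𝕜 fun n => (unitSystem 𝕜).vec (π n) := by
  intro hbasis
  obtain ⟨f, hf, hunb⟩ := exists_unbounded_partial_sums 𝕜
  have hmem : f ∘ π.symm ∈ greedySubmodule 𝕜 := by
    intro ε hε
    obtain ⟨h, ⟨s, hs⟩, hh⟩ := hf ε hε
    exact ⟨h ∘ π.symm, ⟨s.map π.toEmbedding, fun n hn => hs _ fun h' => hn
      (Finset.mem_map.2 ⟨_, h', π.apply_symm_apply n⟩)⟩, hh.comp_perm π.symm⟩
  obtain ⟨x, hx⟩ := exists_toSeq_eq hmem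
  obtain ⟨a, ha, -⟩ := hbasis x
  have hseq : ∀ m k, toSeq (∑ n ∈ Finset.range m, a n • (unitSystem 𝕜).vec (π n)) (π k) =
      if k < m then a k else 0 := by
    intro m k
    simp [unitSystem, map_sum, toSeq_unitVec, Pi.single_apply]
  -- Continuity of the coordinates forces the expansion of `x` along `π` to have coefficients `f`.
  have hcoef : a = f := by
    funext k
    have h1 := ((coord (π k)).continuous.tendsto x).comp ha
    have h2 : Tendsto ((coord (π k) : GreedySpace 𝕜 → 𝕜) ∘
        fun m => ∑ n ∈ Finset.range m, a n • (unitSystem 𝕜).vec (π n)) atTop (𝓝 (a k)) := by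
      refine tendsto_const_nhds.congr' ?_
      filter_upwards [eventually_gt_atTop k] with m hm
      rw [Function.comp_apply, coord_apply, hseq, if_pos hm]
    have h3 := tendsto_nhds_unique h2 h1
    rw [h3, coord_apply, hx]
    simp
  subst hcoef
  have h1 := tendsto_iff.1 ha 1 one_pos
  -- Once a partial sum is within gauge 1 of `x`, its gauge, hence the modulus of the sum of its
  -- coefficients, is at most `7 * (1 + gauge x)`; infinitely many `m` violate this.
  obtain ⟨m, hm1, hm2⟩ := ((hunb (7 * (1 + gauge x))).and_eventually h1).exists
  have h2 := gauge_add_le ((∑ n ∈ Finset.range m, a n • (unitSystem 𝕜).vec (π n)) - x) x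
  rw [sub_add_cancel] at h2
  have h3 := (isGreedyBound_gauge
    (∑ n ∈ Finset.range m, a n • (unitSystem 𝕜).vec (π n))).norm_sum_le_of_support
    (A := (Finset.range m).map π.toEmbedding) fun n hn => by
      have := hseq m (π.symm n)
      rw [π.apply_symm_apply] at this
      rw [this, if_neg]
      exact fun h => hn (Finset.mem_map.2 ⟨_, Finset.mem_range.2 h, π.apply_symm_apply n⟩)
  have h4 : ∑ k ∈ (Finset.range m).map π.toEmbedding,
      toSeq (∑ n ∈ Finset.range m, a n • (unitSystem 𝕜).vec (π n)) k =
      ∑ k ∈ Finset.range m, a k := by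
    rw [Finset.sum_map]
    exact Finset.sum_congr rfl fun k hk => (hseq m k).trans (if_pos (Finset.mem_range.1 hk))
  rw [h4] at h3
  linarith

end GreedySpace

theorem mainTheorem2 (𝕜 : Type u) [RCLike 𝕜] :
    ∃ (Y : Type u) (_ : AddCommGroup Y) (_ : Module 𝕜 Y) (_ : UniformSpace Y)
      (_ : IsUniformAddGroup Y) (q : Y → ℝ) (𝓨 : MinimalSystem 𝕜 Y),
      IsQuasiBanachSpace 𝕜 q ∧
      𝓨.IsMarkushevichBasis ∧
      𝓨.IsAlmostGreedyBasis q ∧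
      𝓨.IsQuasiGreedyBasis q ∧
      𝓨.IsSymmetric q ∧
      ∀ π : Equiv.Perm ℕ, ¬ IsSchauderBasis 𝕜 (fun n => 𝓨.vec (π n)) :=
  ⟨GreedySpace 𝕜, inferInstance, inferInstance, inferInstance, inferInstance, GreedySpace.gauge,
    GreedySpace.unitSystem 𝕜, GreedySpace.isQuasiBanachSpace, GreedySpace.isMarkushevichBasis,
    GreedySpace.isAlmostGreedyBasis, GreedySpace.isQuasiGreedyBasis, GreedySpace.isSymmetric,
    GreedySpace.not_isSchauderBasis⟩
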